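/- Let $q$ be a prime power and let $m,m_1,m_2$ be positive integers with $m_1\mid m$, $m_2\mid m$, $\gcd(m_1,m_2)=e=2$ and $\gcd(m_1/e,\,q-1)=1$. For $i=1,2$ let $\mathrm{Tr}_{q^{m_i}/q}$ be the trace from $\mathbb F_{q^{m_i}}$ to $\mathbb F_q$ and $\mathrm N_{q^m/q^{m_i}}$ the norm from $\mathbb F_{q^m}$ to $\mathbb F_{q^{m_i}}$. Put $$D=\{d\in\mathbb F_{q^m}^{*}:\mathrm{Tr}_{q^{m_2}/q}(\mathrm N_{q^m/q^{m_2}}(d))+1=0\}=\{d_1,\dots,d_n\}$$ and $$\mathcal C_D=\left\{\left(\mathrm{Tr}_{q^{m_1}/q}(x\,\mathrm N_{q^m/q^{m_1}}(d_1)),\dots,\mathrm{Tr}_{q^{m_1}/q}(x\,\mathrm N_{q^m/q^{m_1}}(d_n))\right):x\in\mathbb F_{q^{m_1}}\right\}.$$ Then $\mathcal C_D$ is a two-weight linear code over $\mathbb F_q$ (its nonzero codewords have exactly two distinct Hamming weights) of length $n=\frac{q^{m_2-1}(q^m-1)}{q^{m_2}-1}$ and dimension $m_1$, and its weight enumerator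 is $1+A_1z^{w_1}+A_2z^{w_2}$, where $$w_1=\frac{(q-1)(q^m-1)\left(q^{m_1+m_2}+(-1)^{\frac{m_1+m_2}{2}}q^{\frac{m_1+m_2}{2}+1}\right)}{q^2(q^{m_1}-1)(q^{m_2}-1)},\qquad A_1=\frac{q^{m_1}-1}{q+1},$$ $$w_2=\frac{(q-1)(q^m-1)\left(q^{m_1+m_2}+(-1)^{\frac{m_1+m_2}{2}+1}q^{\frac{m_1+m_2}{2}}\right)}{q^2(q^{m_1}-1)(q^{m_2}-1)},\qquad A_2=\frac{q(q^{m_1}-1)}{q+1}.$$ -/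

import Mathlib

open Polynomial

section Codes

variable {ι F : Type*} [Fintype ι] [Field F]

open Classical in
/-- The weight enumerator `∑_{c ∈ C} z ^ wt(c)` of a linear code `C ⊆ F ^ ι`, where `wt` is the
Hamming weight. The coefficient of `z ^ w` is the number of codewords of weight `w`. -/
noncomputable def weightEnumerator [Fintype F] (C : Submodule F (ι → F)) : ℕ[X] :=
  ∑ c : C, X ^ hammingNorm (c : ι → F)

open Classical in
/-- The set of Hamming weights of the nonzero codewords of `C`. -/
def nonzeroWeights (C : Submodule F (ι → F)) : Set ℕ :=
  {w | ∃ c ∈ C, c ≠ 0 ∧ hammingNorm c = w}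

/-- A two-weight code: its nonzero codewords have exactly two distinct Hamming weights. -/
def IsTwoWeightCode (C : Submodule F (ι → F)) : Prop :=
  (nonzeroWeights C).ncard = 2

/-- A linear `[n, k]` code: length `n` and dimension `k` over `F`. The length is rational here so
that closed formulas with a denominator can be used for it. -/
def HasParameters (C : Submodule F (ι → F)) (n : ℚ) (k : ℕ) : Prop :=
  (Fintype.card ι : ℚ) = n ∧ Module.finrank F C = k

end Codes

/-- The defining set `D = {x ∈ L, x ≠ 0 : Tr_{K₂/F}(N_{L/K₂}(x)) + a = 0}`. -/
def definingSet (F K₂ L : Type*) [Field F] [Field K₂] [Field L] [Algebra F K₂] [Algebra K₂ L]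
    (a : F) : Set L :=
  {x | x ≠ 0 ∧ Algebra.trace F K₂ (Algebra.norm K₂ x) + a = 0}

noncomputable instance instFintypeDefiningSet (F K₂ L : Type*) [Field F] [Field K₂] [Field L]
    [Algebra F K₂] [Algebra K₂ L] [Fintype L] (a : F) : Fintype (definingSet F K₂ L a) :=
  Fintype.ofFinite _

/-- The linear map sending `x ∈ K₁` to the word `(Tr_{K₁/F}(x N_{L/K₁}(d)))_{d ∈ D}`. -/
noncomputable def encode (F K₁ : Type*) {L : Type*} [Field F] [Field K₁] [Field L]
    [Algebra F K₁] [Algebra K₁ L] (D : Set L) : K₁ →ₗ[F] (D → F) :=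
  LinearMap.pi fun d =>
    (Algebra.trace F K₁) ∘ₗ (LinearMap.mulRight F (Algebra.norm K₁ (d : L)))

/-- The code `C_D = {(Tr_{K₁/F}(x N_{L/K₁}(d)))_{d ∈ D} : x ∈ K₁}`, with the coordinates indexed
by `D` itself. -/
noncomputable def codeOf (F K₁ : Type*) {L : Type*} [Field F] [Field K₁] [Field L]
    [Algebra F K₁] [Algebra K₁ L] (D : Set L) : Submodule F (D → F) :=
  LinearMap.range (encode F K₁ D)

/-- Membership in `C_D`, spelled out. -/
theorem mem_codeOf (F K₁ : Type*) {L : Type*} [Field F] [Field K₁] [Field L]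
    [Algebra F K₁] [Algebra K₁ L] (D : Set L) (c : D → F) :
    c ∈ codeOf F K₁ D ↔
      ∃ x : K₁, (fun d : D => Algebra.trace F K₁ (x * Algebra.norm K₁ (d : L))) = c :=
  Iff.rfl

/-! Let q = |F| and let N₁, N₂ be the norms from L to K₁, K₂. The engine is the form Q_a(y) =
Tr_{K/F}(a y^(q+1)), a ≠ 0, on a field K of degree 2k over F. It differs from each of its translates
by an affine function, so a second-moment count of its Z zeros gives (qZ - |K|)² according to
whether Q_a has a radical. The congruence Z ≡ 1 mod q² - 1 then fixes the sign
(`traceFormZeros_eq`). The associated sum S(a) is thus (-q)^k or (-q)^(k+1), and averaging over a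
counts how often each value occurs (`card_hasRadical`).

The weight of the word of b counts the d in Lˣ with Tr(b N₁(d)) ≠ 0 and Tr(N₂(d)) = -1. Since
gcd(m₁/2, q-1) = 1, there are scalings of d that make all nonzero values of the second trace equally
frequent (`exists_norm_eq_algebraMap`), so "= -1" may be traded for "≠ 0". The two indicators are
then invariant under powers with exponents (|Kᵢ|-1)/(q-1), whose gcd is q+1 because gcd(m₁, m₂) = 2.
By Bézout, both may be averaged over (q+1)-th powers without changing their correlation
(`Finset.sum_mul_sum_pow_gcd`), and the averages are governed by the sums S for b N₁(d) and N₂(d).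
The d for which N₂(d) gives a radical lie in one coset of (q+1)-th powers, represented by e, and
there the sum for b N₁(d) is constant. Only S(b N₁(e)) survives
(`sum_traceFormSum_mul_traceFormSum`), and its two values give the two weights. -/

/-! ### Counting along fibers of homomorphisms -/

section Fibers

open Finset

open scoped Classical in
theorem MonoidHom.card_fiber_eq_card_ker {G H : Type*} [Group G] [Fintype G] [Group H]
    (f : G →* H) {h : H} (hh : h ∈ Set.range f) : #{g | f g = h} = Nat.card f.ker := by
  rw [MonoidHom.card_fiber_eq_of_mem_range f hh ⟨1, map_one f⟩, Nat.card_eq_fintype_card,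
    ← Fintype.card_subtype]
  exact Fintype.card_congr (Equiv.refl _)

-- The filtered set is a union of fibers, each a coset of the kernel.
open scoped Classical in
theorem MonoidHom.card_ker_dvd_card_filter {G H : Type*} [Group G] [Fintype G] [Group H]
    (f : G →* H) (P : H → Prop) : Nat.card f.ker ∣ #{g | P (f g)} := by
  rw [card_eq_sum_card_image f]
  refine dvd_sum fun h hh => ?_
  obtain ⟨g, hg, rfl⟩ := mem_image.1 hh
  rw [← f.card_fiber_eq_card_ker ⟨g, rfl⟩]
  apply dvd_of_eq
  congr 1
  ext x
  simp only [mem_filter, mem_univ, true_and] at hg ⊢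
  exact ⟨fun hx => ⟨hx ▸ hg, hx⟩, fun hx => hx.2⟩

theorem MonoidHom.card_filter_mul_card {G H : Type*} [Group G] [Fintype G] [Group H] [Fintype H]
    (f : G →* H) (hf : Function.Surjective f) (P : H → Prop)
    [DecidablePred P] :
    #{g | P (f g)} * Fintype.card H = #{h | P h} * Fintype.card G := by
  classical
  have key (Q : H → Prop) [DecidablePred Q] : #{g | Q (f g)} = #{h | Q h} * Nat.card f.ker := by
    rw [card_eq_sum_card_fiberwise (f := f) (t := ({h | Q h} : Finset H))
      (fun g hg => by simpa using hg), ← smul_eq_mul, ← sum_const]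
    refine sum_congr rfl fun h hh => ?_
    rw [← f.card_fiber_eq_card_ker (hf h)]
    congr 1
    ext x
    simp only [mem_filter, mem_univ, true_and] at hh ⊢
    exact ⟨fun hx => hx.2, fun hx => ⟨hx ▸ hh, hx⟩⟩
  have h1 := key fun _ => True
  simp only [filter_true, card_univ] at h1
  rw [key, h1]
  ring

open scoped Classical in
theorem LinearMap.card_fiber_mul_card {F V : Type*} [Field F] [Fintype F] [AddCommGroup V]
    [Fintype V] [Module F V] (φ : V →ₗ[F] F) (hφ : φ ≠ 0) (c : F) :
    #{v | φ v = c} * Fintype.card F = Fintype.card V := by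
  have hs := LinearMap.surjective (f := φ) hφ
  rw [← card_univ (α := V), card_eq_sum_card_fiberwise (f := (φ : V → F)) (s := univ) (t := univ)
    (fun v _ => mem_coe.2 (mem_univ (φ v))), mul_comm, ← card_univ, ← smul_eq_mul, ← sum_const]
  refine Finset.sum_congr rfl fun d _ => ?_
  exact AddMonoidHom.card_fiber_eq_of_mem_range φ (hs c) (hs d)

end Fibers

/-! ### Power residues and traces in extensions of even degree -/

namespace FiniteField

theorem exists_pow_eq_iff {K : Type*} [Field K] [Fintype K] {n : ℕ}
    (hn : n ∣ Fintype.card K - 1) (x : Kˣ) :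
    (∃ y : Kˣ, y ^ n = x) ↔ x ^ ((Fintype.card K - 1) / n) = 1 := by
  have hpos : 0 < Fintype.card K - 1 := by
    have := Fintype.one_lt_card (α := K); omega
  constructor
  · rintro ⟨y, rfl⟩
    classical
    rw [← pow_mul, Nat.mul_div_cancel' hn, ← Fintype.card_units, pow_card_eq_one]
  · intro h
    obtain ⟨g, hg⟩ := IsCyclic.exists_generator (α := Kˣ)
    obtain ⟨i, rfl⟩ := (mem_powers_iff_mem_zpowers (y := x)).2 (hg x)
    dsimp only at h ⊢
    rw [← pow_mul, ← orderOf_dvd_iff_pow_eq_one, orderOf_eq_card_of_forall_mem_zpowers hg,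
      Nat.card_units, Nat.card_eq_fintype_card] at h
    obtain ⟨l, hl⟩ := hn
    have hn0 : 0 < n := Nat.pos_of_ne_zero (by rintro rfl; simp at hl; omega)
    have hl0 : 0 < l := Nat.pos_of_ne_zero (by rintro rfl; simp at hl; omega)
    rw [hl, Nat.mul_div_cancel_left _ hn0] at h
    obtain ⟨j, rfl⟩ := Nat.dvd_of_mul_dvd_mul_right hl0 h
    exact ⟨g ^ j, by rw [← pow_mul, mul_comm]⟩

variable {F K : Type*} [Field F] [Field K] [Fintype F] [Fintype K] [Algebra F K]

theorem algebraTrace_pow_card (x : K) :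
    Algebra.trace F K (x ^ Fintype.card F) = Algebra.trace F K x := by
  have := Algebra.trace_eq_of_algEquiv (FiniteField.frobeniusAlgEquivOfAlgebraic F K) x
  simpa using this

/-- The conjugates are x, -x, x, ..., and an even number of them cancels. -/
theorem trace_eq_zero_of_pow_card_eq_neg (heven : Even (Module.finrank F K)) {x : K}
    (hx : x ^ Fintype.card F = -x) : Algebra.trace F K x = 0 := by
  apply (algebraMap F K).injective
  have h (i : ℕ) : x ^ (Nat.card F ^ i) = (-1) ^ i * x := by
    induction i with
    | zero => simp
    | succ i ih =>
      have h1 : ((-1 : K) ^ i) ^ Fintype.card F = (-1) ^ i := by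
        have := congrArg (algebraMap F K) (FiniteField.pow_card ((-1 : F) ^ i))
        simpa using this
      rw [pow_succ, pow_mul, ih, Nat.card_eq_fintype_card, mul_pow, hx, h1]
      ring
  rw [algebraMap_trace_eq_sum_pow, map_zero]
  simp only [h, ← Finset.sum_mul]
  rw [neg_one_geom_sum, if_pos heven, zero_mul]

theorem trace_mul_left_ne_zero {c : K} (hc : c ≠ 0) :
    Algebra.trace F K ∘ₗ LinearMap.mulLeft F c ≠ 0 := by
  intro h
  obtain ⟨y, hy⟩ := Algebra.trace_surjective F K 1
  have := LinearMap.congr_fun h (c⁻¹ * y)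
  simp [hc, hy] at this

theorem card_pow_two_sub_one_dvd {k : ℕ} (hk : Module.finrank F K = 2 * k) :
    Fintype.card F ^ 2 - 1 ∣ Fintype.card K - 1 := by
  rw [Module.card_eq_pow_finrank (K := F) (V := K), hk, pow_mul]
  simpa using Nat.sub_dvd_pow_sub_pow (Fintype.card F ^ 2) 1 k

theorem _root_.Nat.sq_sub_one (n : ℕ) : n ^ 2 - 1 = (n + 1) * (n - 1) := by
  simpa using Nat.sq_sub_sq n 1

theorem card_add_one_dvd {k : ℕ} (hk : Module.finrank F K = 2 * k) :
    Fintype.card F + 1 ∣ Fintype.card K - 1 :=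
  (Dvd.intro _ (Nat.sq_sub_one _).symm).trans (card_pow_two_sub_one_dvd hk)

/-- Such an x is y^l with l = (|K|-1)/(q-1), and y^l is the norm of y. -/
theorem exists_algebraMap_eq_of_pow_eq_one {x : Kˣ} (hx : x ^ (Fintype.card F - 1) = 1) :
    ∃ s : F, s ≠ 0 ∧ algebraMap F K s = x := by
  have hdvd : Fintype.card F - 1 ∣ Fintype.card K - 1 := by
    rw [Module.card_eq_pow_finrank (K := F) (V := K)]
    simpa using Nat.sub_dvd_pow_sub_pow (Fintype.card F) 1 (Module.finrank F K)
  have hK := Fintype.one_lt_card (α := K)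
  obtain ⟨l, hl⟩ := hdvd
  have hl0 : 0 < l := Nat.pos_of_ne_zero (by rintro rfl; simp at hl; omega)
  have hF0 : 0 < Fintype.card F - 1 := Nat.pos_of_ne_zero (by intro h; rw [h] at hl; simp at hl; omega)
  obtain ⟨y, rfl⟩ := (exists_pow_eq_iff (n := l) (Dvd.intro_left _ hl.symm) x).2 (by
    rw [hl, Nat.mul_div_cancel _ hl0, hx])
  refine ⟨Algebra.norm F (y : K), by simp [Algebra.norm_eq_zero_iff], ?_⟩
  rw [algebraMap_norm_eq_pow, Nat.card_eq_fintype_card, Nat.card_eq_fintype_card, hl,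
    Nat.mul_div_cancel_left _ hF0, Units.val_pow_eq_pow_val]

/-- In even degree q-1 divides (|K|-1)/(q+1), so s meets the power-residue criterion. -/
theorem exists_pow_card_add_one_eq {k : ℕ} (hk : Module.finrank F K = 2 * k) {s : F} (hs : s ≠ 0) :
    ∃ w : Kˣ, (w : K) ^ (Fintype.card F + 1) = algebraMap F K s := by
  obtain ⟨w, hw⟩ := (exists_pow_eq_iff (card_add_one_dvd hk)
    (Units.map (algebraMap F K).toMonoidHom (Units.mk0 s hs))).2 (by
      obtain ⟨l, hl⟩ := card_pow_two_sub_one_dvd hk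
      rw [hl, Nat.sq_sub_one, mul_assoc, Nat.mul_div_cancel_left _ (by omega), pow_mul,
        ← map_pow]
      have : Units.mk0 s hs ^ (Fintype.card F - 1) = 1 := by
        ext
        simpa using FiniteField.pow_card_sub_one_eq_one s hs
      rw [this, map_one, one_pow])
  exact ⟨w, by simpa using congrArg Units.val hw⟩

/-! ### Zeros of the form Tr(a y^(q+1)) -/

open Finset

variable (F) in
/-- The form `y ↦ Tr_{K/F}(a y ^ (q + 1))`, where `q` is the cardinality of `F`. -/
noncomputable def traceForm (a y : K) : F :=
  Algebra.trace F K (a * y ^ (Fintype.card F + 1))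

open scoped Classical in
variable (F) in
/-- The number of zeros of the form `y ↦ Tr_{K/F}(a y ^ (q + 1))`. -/
noncomputable def traceFormZeros (a : K) : ℕ := #{y : K | traceForm F a y = 0}

variable (F) in
/-- The form `y ↦ Tr_{K/F}(a y ^ (q + 1))` has a nonzero radical vector. -/
def HasRadical (a : K) : Prop :=
  ∃ z : Kˣ, a ^ (Fintype.card F - 1) * (z : K) ^ (Fintype.card F ^ 2 - 1) = -1

omit [Fintype K] in
theorem traceForm_zero (a : K) : traceForm F a 0 = 0 := by simp [traceForm]

omit [Fintype K] in
theorem traceForm_mul_of_pow_eq (a y : K) {w : K} {s : F}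
    (hw : w ^ (Fintype.card F + 1) = algebraMap F K s) :
    traceForm F a (w * y) = s * traceForm F a y := by
  rw [traceForm, traceForm, mul_pow, hw, mul_left_comm, ← Algebra.smul_def, map_smul, smul_eq_mul]

-- Multiplication by w with w^(q+1) = t/s carries the fiber over s to the fiber over t, so all
-- nonzero values are equally frequent.
open scoped Classical in
theorem card_traceForm_fiber {k : ℕ} (hk : Module.finrank F K = 2 * k) (a : K) {t : F}
    (ht : t ≠ 0) :
    (Fintype.card F - 1) * #{y : K | traceForm F a y = t} + traceFormZeros F a =
      Fintype.card K := by
  have h (s : F) (hs : s ∈ univ.erase (0 : F)) :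
      #{y : K | traceForm F a y = s} = #{y : K | traceForm F a y = t} := by
    rw [mem_erase] at hs
    obtain ⟨w, hw⟩ := exists_pow_card_add_one_eq hk (div_ne_zero ht hs.1)
    refine card_bijective (Units.mulLeft w) (Units.mulLeft w).bijective fun y => ?_
    simp only [mem_filter, mem_univ, true_and, Units.mulLeft_apply]
    rw [traceForm_mul_of_pow_eq a y hw, div_mul_eq_mul_div, div_eq_iff hs.1]
    simp [ht]
  rw [← card_univ (α := K), card_eq_sum_card_fiberwise (f := traceForm F a) (s := univ) (t := univ)
    (fun v _ => mem_coe.2 (mem_univ _)), ← sum_erase_add _ _ (mem_univ (0 : F)),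
    sum_congr rfl h, sum_const, card_erase_of_mem (mem_univ _), card_univ, smul_eq_mul]
  rfl

theorem add_pow_card_add_one (y z : K) :
    (y + z) ^ (Fintype.card F + 1) = y ^ (Fintype.card F + 1) +
      (y ^ Fintype.card F * z + z ^ Fintype.card F * y) + z ^ (Fintype.card F + 1) := by
  have := map_add (frobeniusAlgEquivOfAlgebraic F K) y z
  simp only [coe_frobeniusAlgEquivOfAlgebraic] at this
  rw [pow_succ, this]
  ring

/-- Polarization. With w^q = a z, the cross term Tr(a z y^q) is Tr((w y)^q) = Tr(w y), hence c = w +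
a z^q. -/
theorem traceForm_add (a z : K) :
    ∃ c : K, c ^ Fintype.card F = a * z + a ^ Fintype.card F * z ^ Fintype.card F ^ 2 ∧
      ∀ y, traceForm F a (y + z) = traceForm F a y + Algebra.trace F K (c * y) +
        traceForm F a z := by
  obtain ⟨w, hw⟩ := (frobeniusAlgEquivOfAlgebraic F K).surjective (a * z)
  have hadd := map_add (frobeniusAlgEquivOfAlgebraic F K) w (a * z ^ Fintype.card F)
  simp only [coe_frobeniusAlgEquivOfAlgebraic] at hw hadd
  refine ⟨w + a * z ^ Fintype.card F, ?_, fun y => ?_⟩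
  · rw [hadd, hw, mul_pow, ← pow_mul, sq]
  · simp only [traceForm]
    rw [add_mul, map_add, ← algebraTrace_pow_card (F := F) (w * y), mul_pow, hw,
      add_pow_card_add_one, mul_add, mul_add, map_add, map_add, mul_add, map_add]
    ring_nf

omit [Fintype K] [Algebra F K] in
theorem radical_eq_iff (a : K) (z : Kˣ) (ha : a ≠ 0) :
    a * z + a ^ Fintype.card F * (z : K) ^ Fintype.card F ^ 2 = 0 ↔
      a ^ (Fintype.card F - 1) * (z : K) ^ (Fintype.card F ^ 2 - 1) = -1 := by
  have h0 : 0 < Fintype.card F := Fintype.card_pos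
  obtain ⟨n, hn⟩ : ∃ n, Fintype.card F = n + 1 := ⟨_, (Nat.sub_add_cancel h0).symm⟩
  obtain ⟨l, hl⟩ : ∃ l, Fintype.card F ^ 2 = l + 1 :=
    ⟨_, (Nat.sub_add_cancel (pow_pos h0 2)).symm⟩
  rw [hl, hn, Nat.add_sub_cancel, Nat.add_sub_cancel]
  have : a * z + a ^ (n + 1) * (z : K) ^ (l + 1) = a * z * (1 + a ^ n * (z : K) ^ l) := by ring
  rw [this, mul_eq_zero, or_iff_right (mul_ne_zero ha z.ne_zero), add_comm, add_eq_zero_iff_eq_neg]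

/-- Frobenius negates a z^(q+1). Translation by a radical vector therefore preserves the form
exactly, not just up to a constant. -/
theorem traceForm_eq_zero_of_radical (heven : Even (Module.finrank F K)) (a z : K)
    (h : a * z + a ^ Fintype.card F * z ^ Fintype.card F ^ 2 = 0) : traceForm F a z = 0 := by
  refine trace_eq_zero_of_pow_card_eq_neg heven ?_
  have : (a * z ^ (Fintype.card F + 1)) ^ Fintype.card F =
      a ^ Fintype.card F * z ^ Fintype.card F ^ 2 * z ^ Fintype.card F := by
    rw [mul_pow, ← pow_mul]; ring
  rw [this, eq_neg_of_add_eq_zero_right h]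
  ring

open scoped Classical in
theorem card_traceForm_add_eq (heven : Even (Module.finrank F K)) (a z : K) :
    #{y : K | traceForm F a (y + z) = traceForm F a y} * Fintype.card F =
      if a * z + a ^ Fintype.card F * z ^ Fintype.card F ^ 2 = 0
        then Fintype.card K * Fintype.card F else Fintype.card K := by
  obtain ⟨c, hc, hadd⟩ := traceForm_add (F := F) a z
  split_ifs with h
  · have hc0 : c = 0 := by
      rw [h] at hc
      exact pow_eq_zero_iff (Fintype.card_ne_zero) |>.1 hc
    rw [filter_true_of_mem, card_univ]
    intro y _
    rw [hadd, hc0, zero_mul, map_zero, traceForm_eq_zero_of_radical heven a z h]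
    simp
  · have hc0 : c ≠ 0 := by
      rintro rfl
      rw [zero_pow Fintype.card_ne_zero] at hc
      exact h hc.symm
    rw [← LinearMap.card_fiber_mul_card _ (trace_mul_left_ne_zero (F := F) hc0)
      (-traceForm F a z)]
    congr 2
    ext y
    rw [mem_filter, mem_filter, hadd, add_assoc, add_eq_left, add_eq_zero_iff_eq_neg]
    rfl

omit [Field F] [Fintype F] [Algebra F K] in
theorem card_filter_eq_add_card_units [DecidableEq K] (P : K → Prop) [DecidablePred P] :
    #{y : K | P y} = (if P 0 then 1 else 0) + #{u : Kˣ | P u} := by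
  have h : #{u : Kˣ | P u} = #{y ∈ univ.erase (0 : K) | P y} := by
    refine card_bij (fun u _ => (u : K)) (by simp) (by simp [Units.ext_iff]) fun y hy => ?_
    simp only [mem_filter, mem_erase, mem_univ, and_true] at hy
    exact ⟨Units.mk0 y hy.1, by simpa using hy.2, rfl⟩
  rw [h, filter_erase]
  split_ifs with h0
  · rw [add_comm, card_erase_add_one (by simpa using h0)]
  · rw [erase_eq_of_notMem (by simpa using h0), zero_add]

-- The nonzero solutions form a fiber of u ↦ u^(q²-1), either empty or of size q²-1; z = 0 supplies
-- the remaining 1.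
open scoped Classical in
theorem card_radical {k : ℕ} (hk : Module.finrank F K = 2 * k) {a : K} (ha : a ≠ 0) :
    #{z : K | a * z + a ^ Fintype.card F * z ^ Fintype.card F ^ 2 = 0} =
      if HasRadical F a then Fintype.card F ^ 2 else 1 := by
  rw [card_filter_eq_add_card_units, if_pos (by simp [Fintype.card_ne_zero])]
  simp only [radical_eq_iff _ _ ha]
  split_ifs with h
  · obtain ⟨z, hz⟩ := h
    have h2 := (powMonoidHom (Fintype.card F ^ 2 - 1) : Kˣ →* Kˣ).card_fiber_eq_card_ker ⟨z, rfl⟩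
    rw [IsCyclic.card_powMonoidHom_ker, Nat.card_units, Nat.card_eq_fintype_card,
      Nat.gcd_eq_right (card_pow_two_sub_one_dvd hk)] at h2
    have h3 : 0 < Fintype.card F ^ 2 := pow_pos Fintype.card_pos 2
    refine Eq.trans ?_ (Nat.add_sub_cancel' h3)
    refine congrArg (1 + ·) (Eq.trans (card_bijective id Function.bijective_id fun u => ?_) h2)
    simp only [id, mem_filter, mem_univ, true_and, powMonoidHom_apply]
    rw [← hz, mul_right_inj' (pow_ne_zero _ ha), Units.ext_iff]
    simp
  · rw [filter_false_of_mem, card_empty]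
    exact fun z _ hz => h ⟨z, hz⟩

open scoped Classical in
theorem sum_card_traceForm_add_eq (a : K) :
    ∑ z : K, #{y : K | traceForm F a (y + z) = traceForm F a y} =
      ∑ y : K, #{x : K | traceForm F a x = traceForm F a y} := by
  simp only [card_filter]
  rw [sum_comm]
  refine sum_congr rfl fun y _ => ?_
  exact Fintype.sum_equiv (Equiv.addLeft y) _ _ (fun z => rfl)

-- Second moment: the pairs with equal form values are counted once by their difference z and once
-- by their common value.
open scoped Classical in
theorem traceFormZeros_quadratic {k : ℕ} (hk : Module.finrank F K = 2 * k) {a : K} (ha : a ≠ 0) :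
    ((Fintype.card F : ℤ) * traceFormZeros F a - Fintype.card K) ^ 2 =
      ((Fintype.card F : ℤ) - 1) ^ 2 * Fintype.card K *
        (if HasRadical F a then (Fintype.card F : ℤ) ^ 2 else 1) := by
  have heven : Even (Module.finrank F K) := hk ▸ even_two_mul k
  have hcast : (if HasRadical F a then (Fintype.card F : ℤ) ^ 2 else 1) =
      (#{z : K | a * z + a ^ Fintype.card F * z ^ Fintype.card F ^ 2 = 0} : ℤ) := by
    rw [card_radical hk ha]
    split_ifs <;> simp
  rw [hcast]
  -- By difference: a radical z contributes |K|, any other z contributes |K|/q.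
  have hleft : (∑ z : K, (#{y : K | traceForm F a (y + z) = traceForm F a y} : ℤ)) *
      Fintype.card F =
      #{z : K | a * z + a ^ Fintype.card F * z ^ Fintype.card F ^ 2 = 0} *
        ((Fintype.card K : ℤ) * (Fintype.card F - 1)) + Fintype.card K * Fintype.card K := by
    have hz (z : K) : (#{y : K | traceForm F a (y + z) = traceForm F a y} : ℤ) *
        Fintype.card F = (if a * z + a ^ Fintype.card F * z ^ Fintype.card F ^ 2 = 0 then
          (Fintype.card K : ℤ) * (Fintype.card F - 1) else 0) + Fintype.card K := by
      rw [← Nat.cast_mul, card_traceForm_add_eq heven]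
      split_ifs <;> push_cast <;> ring
    rw [sum_mul, sum_congr rfl fun z _ => hz z, sum_add_distrib, ← sum_filter, sum_const,
      sum_const, card_univ, nsmul_eq_mul, nsmul_eq_mul]
  have hF : 1 ≤ Fintype.card F := Fintype.card_pos
  have hfib := card_traceForm_fiber hk a (one_ne_zero : (1 : F) ≠ 0)
  -- By value: the zero fiber has Z elements, every other fiber (|K| - Z)/(q-1).
  have hright : ((Fintype.card F : ℤ) - 1) *
      ∑ y : K, (#{x : K | traceForm F a x = traceForm F a y} : ℤ) =
      (Fintype.card F - 1) * (traceFormZeros F a : ℤ) ^ 2 +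
        (Fintype.card K - traceFormZeros F a) ^ 2 := by
    have hz (y : K) : ((Fintype.card F : ℤ) - 1) * #{x : K | traceForm F a x = traceForm F a y} =
        (if traceForm F a y = 0 then Fintype.card F * (traceFormZeros F a : ℤ) - Fintype.card K
          else 0) + (Fintype.card K - traceFormZeros F a) := by
      split_ifs with hy
      · rw [hy, ← traceFormZeros]
        ring
      · have := card_traceForm_fiber hk a hy
        zify [hF] at this
        linarith
    rw [mul_sum, sum_congr rfl fun y _ => hz y, sum_add_distrib, ← sum_filter, sum_const,
      sum_const, ← traceFormZeros, card_univ, nsmul_eq_mul, nsmul_eq_mul]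
    ring
  have hsum := congrArg (Nat.cast (R := ℤ)) (sum_card_traceForm_add_eq (F := F) a)
  push_cast at hsum
  rw [hsum] at hleft
  linear_combination (-(Fintype.card F : ℤ)) * hright + ((Fintype.card F : ℤ) - 1) * hleft

/-- If ζ^(q²-1) = 1, then ζ^(q+1) lies in Fˣ, so multiplication by ζ permutes the nonzero zeros.
This congruence later decides the sign of the square root. -/
theorem dvd_traceFormZeros_sub_one {k : ℕ} (hk : Module.finrank F K = 2 * k) (a : K) :
    ∃ f : ℕ, traceFormZeros F a = 1 + (Fintype.card F ^ 2 - 1) * f := by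
  classical
  rw [traceFormZeros, card_filter_eq_add_card_units, if_pos (traceForm_zero a)]
  -- Vanishing at u depends only on u^(q²-1), the shape needed for
  -- `MonoidHom.card_ker_dvd_card_filter`.
  have h (u : Kˣ) : traceForm F a u = 0 ↔ 
      ∃ v : Kˣ, powMonoidHom (Fintype.card F ^ 2 - 1) v =
        powMonoidHom (Fintype.card F ^ 2 - 1) u ∧ traceForm F a v = 0 := by
    refine ⟨fun h => ⟨u, rfl, h⟩, fun ⟨v, hv, h⟩ => ?_⟩
    simp only [powMonoidHom_apply] at hv
    have h1 : ((u / v) ^ (Fintype.card F + 1)) ^ (Fintype.card F - 1) = 1 := by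
      rw [← pow_mul, ← Nat.sq_sub_one, div_pow, hv, div_self']
    obtain ⟨s, hs, hsw⟩ := exists_algebraMap_eq_of_pow_eq_one h1
    rw [Units.val_pow_eq_pow_val] at hsw
    have := traceForm_mul_of_pow_eq a v hsw.symm
    rw [h, mul_zero, ← Units.val_mul, div_mul_cancel] at this
    exact this
  obtain ⟨f, hf⟩ := MonoidHom.card_ker_dvd_card_filter
    (powMonoidHom (Fintype.card F ^ 2 - 1) : Kˣ →* Kˣ)
    (fun x => ∃ v : Kˣ, powMonoidHom (Fintype.card F ^ 2 - 1) v = x ∧ traceForm F a v = 0)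
  refine ⟨f, ?_⟩
  simp only [← h] at hf
  rw [hf, IsCyclic.card_powMonoidHom_ker, Nat.card_units, Nat.card_eq_fintype_card,
        Nat.gcd_eq_right (card_pow_two_sub_one_dvd hk)]

variable (F) in
open scoped Classical in
/-- The value `∑ y, χ (Tr_{K/F}(a y ^ (q + 1)))` for any nontrivial additive character `χ` of `F`,
where `K` has degree `2 k` over `F` and `a ≠ 0`. -/
noncomputable def traceFormSum (k : ℕ) (a : K) : ℤ :=
  (-(Fintype.card F : ℤ)) ^ (if HasRadical F a then k + 1 else k)

open scoped Classical in
theorem traceFormZeros_eq {k : ℕ} (hk : Module.finrank F K = 2 * k) {a : K} (ha : a ≠ 0) :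
    (Fintype.card F : ℤ) * traceFormZeros F a = Fintype.card K + (Fintype.card F - 1) *
      traceFormSum F k a := by
  rw [traceFormSum]
  have hquad := traceFormZeros_quadratic hk ha
  have hF : 2 ≤ Fintype.card F := Fintype.one_lt_card
  have hK : Fintype.card K = (Fintype.card F ^ 2) ^ k := by
    rw [Module.card_eq_pow_finrank (K := F) (V := K), hk, pow_mul]
  obtain ⟨f, hf⟩ := dvd_traceFormZeros_sub_one hk a
  have hFz : (2 : ℤ) ≤ Fintype.card F := by exact_mod_cast hF
  have hfz : (traceFormZeros F a : ℤ) = 1 + ((Fintype.card F : ℤ) ^ 2 - 1) * f := by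
    rw [hf]
    push_cast [Nat.one_le_pow 2 _ (by omega : 0 < Fintype.card F)]
    ring
  have hKz : (Fintype.card K : ℤ) = ((Fintype.card F : ℤ) ^ 2) ^ k := by exact_mod_cast hK
  generalize (Fintype.card F : ℤ) = q at *
  generalize (Fintype.card K : ℤ) = Q at *
  generalize (traceFormZeros F a : ℤ) = Z at *
  have hsq : (q * Z - Q) ^ 2 =
      ((q - 1) * (-q) ^ (if HasRadical F a then k + 1 else k)) ^ 2 := by
    have hj (j : ℕ) : ((-q) ^ j) ^ 2 = (q ^ 2) ^ j := by
      rw [← pow_mul, mul_comm, pow_mul, neg_sq]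
    rw [hquad, hKz, mul_pow, hj]
    split_ifs <;> ring
  rcases sq_eq_sq_iff_eq_or_eq_neg.1 hsq with h | h
  · linarith
  -- With the wrong sign, dividing by q-1 and reducing modulo q+1 (where -q ≡ 1) gives q+1 ∣ 2,
  -- impossible for q ≥ 2.
  · exfalso
    generalize (if HasRadical F a then k + 1 else k) = j at h
    obtain ⟨u, hu⟩ : q ^ 2 - 1 ∣ (q ^ 2) ^ k - 1 := sub_one_dvd_pow_sub_one _ _
    obtain ⟨v, hv⟩ : -q - 1 ∣ (-q) ^ j - 1 := sub_one_dvd_pow_sub_one _ _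
    have hdvd : (q - 1) * ((q + 1) * (v + u - q * f)) = (q - 1) * 2 := by
      linear_combination -h + (q - 1) * hv - (hu + hKz) + q * hfz
    have h2 := Int.le_of_dvd two_pos (Dvd.intro _ (mul_left_cancel₀ (by linarith) hdvd))
    linarith

open scoped Classical in
theorem sum_traceFormZeros :
    (∑ a : Kˣ, traceFormZeros F (a : K)) * Fintype.card F =
      (Fintype.card K - 1) * Fintype.card K := by
  have hK : 1 ≤ Fintype.card K := Fintype.card_pos
  have hu (y : Kˣ) : #{a : Kˣ | traceForm F (a : K) y = 0} * Fintype.card F + Fintype.card F =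
      Fintype.card K := by
    have hc := LinearMap.card_fiber_mul_card _ (trace_mul_left_ne_zero (F := F)
      (pow_ne_zero (Fintype.card F + 1) y.ne_zero)) 0
    rw [← hc, card_filter_eq_add_card_units (fun v => (Algebra.trace F K ∘ₗ LinearMap.mulLeft F
      ((y : K) ^ (Fintype.card F + 1))) v = 0), if_pos (map_zero _), add_mul, one_mul, add_comm]
    simp only [traceForm, LinearMap.comp_apply, LinearMap.mulLeft_apply, mul_comm, add_right_inj]
    congr
  have h0 : #{a : Kˣ | traceForm F (a : K) (0 : K) = 0} = Fintype.card K - 1 := by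
    simp [traceForm_zero, Fintype.card_units]
  have hswap : ∑ a : Kˣ, traceFormZeros F (a : K) =
      #{a : Kˣ | traceForm F (a : K) (0 : K) = 0} +
        ∑ y : Kˣ, #{a : Kˣ | traceForm F (a : K) y = 0} := by
    simp only [traceFormZeros, card_filter_eq_add_card_units (K := K)]
    rw [sum_add_distrib, ← card_filter]
    congr 1
    simp only [card_filter]
    rw [sum_comm]
  have hsum : ∑ y : Kˣ, (#{a : Kˣ | traceForm F (a : K) y = 0} * Fintype.card F +
      Fintype.card F) = (Fintype.card K - 1) * Fintype.card K := by
    rw [sum_congr rfl fun y _ => hu y, sum_const, card_univ, Fintype.card_units, smul_eq_mul]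
  rw [hswap, h0, add_mul, sum_mul, ← hsum, sum_add_distrib, sum_const, card_univ,
    Fintype.card_units, smul_eq_mul, add_comm]

-- The total number of zeros over all a is known from `sum_traceFormZeros`. Since each a contributes
-- one of two values, this is a linear equation for the count.
open scoped Classical in
theorem card_hasRadical {k : ℕ} (hk : Module.finrank F K = 2 * k) :
    #{a : Kˣ | HasRadical F (a : K)} * (Fintype.card F + 1) = Fintype.card K - 1 := by
  have hF : 2 ≤ Fintype.card F := Fintype.one_lt_card
  have hK : 1 ≤ Fintype.card K := Fintype.card_pos
  have hsum := sum_traceFormZeros (F := F) (K := K)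
  have hz (a : Kˣ) : (Fintype.card F : ℤ) * traceFormZeros F (a : K) =
      Fintype.card K + (Fintype.card F - 1) * (-(Fintype.card F : ℤ)) ^ k *
        (1 - if HasRadical F (a : K) then (Fintype.card F + 1 : ℤ) else 0) := by
    rw [traceFormZeros_eq hk a.ne_zero, traceFormSum]
    split_ifs <;> ring
  zify [hK] at hsum ⊢
  rw [mul_comm, mul_sum, sum_congr rfl fun a _ => hz a, sum_add_distrib, sum_const, ← mul_sum,
    sum_sub_distrib, ← sum_filter, sum_const, sum_const, card_univ, Fintype.card_units,
    nsmul_eq_mul, nsmul_eq_mul, nsmul_eq_mul, Nat.cast_sub hK] at hsum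
  have hne : ((Fintype.card F : ℤ) - 1) * (-(Fintype.card F : ℤ)) ^ k ≠ 0 := by
    have : (2 : ℤ) ≤ Fintype.card F := by exact_mod_cast hF
    exact mul_ne_zero (by linarith) (pow_ne_zero _ (by linarith))
  apply mul_left_cancel₀ hne
  push_cast at hsum
  linear_combination -hsum

/-- (a/b)^(q-1) is a (q²-1)-th power. The conclusion is the criterion for a/b to be a (q+1)-th
power. -/
theorem HasRadical.div_pow_eq_one {k : ℕ} (hk : Module.finrank F K = 2 * k) {a b : Kˣ}
    (ha : HasRadical F (a : K)) (hb : HasRadical F (b : K)) :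
    (a / b) ^ ((Fintype.card K - 1) / (Fintype.card F + 1)) = 1 := by
  obtain ⟨z, hz⟩ := ha
  obtain ⟨w, hw⟩ := hb
  have h : (a / b) ^ (Fintype.card F - 1) = (w / z) ^ (Fintype.card F ^ 2 - 1) := by
    rw [div_pow, div_pow, div_eq_div_iff_mul_eq_mul]
    ext
    push_cast
    rw [hz, mul_comm, hw]
  obtain ⟨l, hl⟩ := card_pow_two_sub_one_dvd hk
  classical
  have hl' := hl
  rw [Nat.sq_sub_one, mul_assoc] at hl'
  rw [hl', Nat.mul_div_cancel_left _ (Nat.succ_pos _), pow_mul, h, ← pow_mul, ← hl,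
    ← Fintype.card_units, pow_card_eq_one]

end FiniteField

/-! ### Averaging a correlation over powers -/

/-- By Bézout y^gcd is an m-th power times an n-th power. For given y and z, translating d by the
n-th power part of y^gcd and the m-th power part of z^gcd absorbs both shifts, so every pair (y, z)
contributes the same correlation. -/
theorem Finset.sum_mul_sum_pow_gcd {G R : Type*} [CommGroup G] [Fintype G] [CommRing R]
    {m n : ℕ} (f g : G → R) (hf : ∀ d x, f (d * x ^ m) = f d) (hg : ∀ d x, g (d * x ^ n) = g d) :
    ∑ d, (∑ y, f (d * y ^ m.gcd n)) * ∑ y, g (d * y ^ m.gcd n) =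
      (Fintype.card G : R) ^ 2 * ∑ d, f d * g d := by
  have hbez (y : G) : y ^ m.gcd n = (y ^ m.gcdA n) ^ m * (y ^ m.gcdB n) ^ n := by
    rw [← zpow_natCast, Nat.gcd_eq_gcd_ab, zpow_add, zpow_mul', zpow_mul', zpow_natCast,
      zpow_natCast]
  have hpair (y z : G) :
      ∑ d, f (d * y ^ m.gcd n) * g (d * z ^ m.gcd n) = ∑ d, f d * g d := by
    refine Fintype.sum_equiv (Equiv.mulRight ((y ^ m.gcdB n) ^ n * (z ^ m.gcdA n) ^ m)) _ _
      fun d => ?_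
    simp only [Equiv.coe_mulRight]
    congr 1
    · rw [← mul_assoc, hf, hbez, mul_comm ((y ^ m.gcdA n) ^ m), ← mul_assoc, hf]
    · rw [mul_comm ((y ^ m.gcdB n) ^ n), ← mul_assoc, hg, hbez, ← mul_assoc, hg]
  simp only [Finset.sum_mul_sum]
  rw [Finset.sum_comm]
  rw [Finset.sum_congr rfl fun y _ => Finset.sum_comm]
  simp only [hpair, Finset.sum_const, Finset.card_univ, nsmul_eq_mul]
  ring

/-! ### Pulling the form back along a norm -/

namespace FiniteField

open Finset

section Tower

variable {F K L : Type*} [Field F] [Field K] [Field L] [Fintype F] [Fintype K] [Fintype L]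
  [Algebra F K] [Algebra K L]

omit [Field F] [Fintype K] [Algebra F K] in
open scoped Classical in
theorem traceFormSum_eq_mul (k : ℕ) (a : K) :
    traceFormSum F k a = (-(Fintype.card F : ℤ)) ^ k *
      (1 - if HasRadical F a then (Fintype.card F + 1 : ℤ) else 0) := by
  rw [traceFormSum]
  split_ifs <;> ring

omit [Field F] [Fintype K] [Algebra F K] in
theorem hasRadical_mul_pow_iff (a : K) (w : Kˣ) :
    HasRadical F (a * (w : K) ^ (Fintype.card F + 1)) ↔ HasRadical F a := by
  have h (z : Kˣ) : (a * (w : K) ^ (Fintype.card F + 1)) ^ (Fintype.card F - 1) *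
      (z : K) ^ (Fintype.card F ^ 2 - 1) =
      a ^ (Fintype.card F - 1) * ((w * z : Kˣ) : K) ^ (Fintype.card F ^ 2 - 1) := by
    push_cast
    rw [mul_pow, mul_pow, ← pow_mul, ← Nat.sq_sub_one, mul_assoc]
  refine ⟨fun ⟨z, hz⟩ => ⟨w * z, by rw [← h, hz]⟩, fun ⟨z, hz⟩ => ⟨w⁻¹ * z, ?_⟩⟩
  rw [h, mul_inv_cancel_left, hz]

variable (K L) in
theorem card_sub_one_dvd_card_sub_one : Fintype.card K - 1 ∣ Fintype.card L - 1 := by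
  rw [Module.card_eq_pow_finrank (K := K) (V := L)]
  simpa using Nat.sub_dvd_pow_sub_pow (Fintype.card K) 1 (Module.finrank K L)

/-- In L the norm is the power (|L|-1)/(|K|-1), so the residue criterion for N(d)/N(e) in K is the
one for d/e in L. -/
theorem exists_eq_mul_pow_of_hasRadical_norm {k : ℕ} (hk : Module.finrank F K = 2 * k) {d e : Lˣ}
    (hd : HasRadical F (Algebra.norm K (d : L))) (he : HasRadical F (Algebra.norm K (e : L))) :
    ∃ y : Lˣ, d = e * y ^ (Fintype.card F + 1) := by
  have hK := Fintype.one_lt_card (α := K)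
  obtain ⟨l, hl⟩ := card_sub_one_dvd_card_sub_one K L
  have hdiv := HasRadical.div_pow_eq_one hk (a := Units.map (Algebra.norm K) d)
    (b := Units.map (Algebra.norm K) e) hd he
  obtain ⟨n, hn⟩ := card_add_one_dvd hk
  have hn0 : 0 < Fintype.card F + 1 := Nat.succ_pos _
  obtain ⟨y, hy⟩ := (exists_pow_eq_iff (K := L) ((card_add_one_dvd hk).trans ⟨l, hl⟩) (d / e)).2 (by
    have h := congrArg (fun x : Kˣ => algebraMap K L x) hdiv
    rw [← _root_.map_div, ← map_pow] at h
    simp only [Units.coe_map, Units.val_one, map_one] at h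
    rw [algebraMap_norm_eq_pow, Nat.card_eq_fintype_card, Nat.card_eq_fintype_card, hl,
      Nat.mul_div_cancel_left _ (by omega), hn, Nat.mul_div_cancel_left _ hn0,
      Units.val_pow_eq_pow_val, ← pow_mul] at h
    rw [hl, hn, mul_assoc, Nat.mul_div_cancel_left _ hn0]
    ext
    simpa using h)
  exact ⟨y, by rw [hy, mul_div_cancel]⟩

open scoped Classical in
theorem card_hasRadical_norm {k : ℕ} (hk : Module.finrank F K = 2 * k) (b : Kˣ) :
    #{d : Lˣ | HasRadical F ((b : K) * Algebra.norm K (d : L))} * (Fintype.card F + 1) =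
      Fintype.card L - 1 := by
  have hK := Fintype.one_lt_card (α := K)
  have h := MonoidHom.card_filter_mul_card (Units.map (Algebra.norm K (S := L)))
    (unitsMap_norm_surjective K L) (fun a => HasRadical F ((b : K) * a))
  have hb : #{a : Kˣ | HasRadical F ((b : K) * a)} = #{a : Kˣ | HasRadical F (a : K)} :=
    card_bijective (Equiv.mulLeft b) (Equiv.mulLeft b).bijective (by simp)
  rw [hb, Fintype.card_units, Fintype.card_units] at h
  have h' := congrArg (· * (Fintype.card F + 1)) h
  rw [mul_right_comm, mul_right_comm (#{a : Kˣ | HasRadical F (a : K)}), card_hasRadical hk,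
    mul_comm] at h'
  exact Nat.eq_of_mul_eq_mul_left (by omega) h'

-- The values (-q)^k and -q(-q)^k occur in proportion q : 1 and cancel.
open scoped Classical in
theorem sum_traceFormSum_norm {k : ℕ} (hk : Module.finrank F K = 2 * k) (b : Kˣ) :
    ∑ d : Lˣ, traceFormSum F k ((b : K) * Algebra.norm K (d : L)) = 0 := by
  classical
  have h := card_hasRadical_norm (L := L) hk b
  have hL : 1 ≤ Fintype.card L := Fintype.card_pos
  zify [hL] at h
  simp only [traceFormSum_eq_mul]
  rw [← mul_sum, sum_sub_distrib, ← sum_filter, sum_const, sum_const, card_univ,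
    Fintype.card_units, nsmul_eq_mul, nsmul_eq_mul, Nat.cast_sub hL, h]
  simp

variable (F) in
open scoped Classical in
/-- The indicator of `Tr_{K/F}(b N_{L/K}(d)) ≠ 0`. -/
noncomputable def traceNormIndicator (b : K) (d : Lˣ) : ℤ :=
  if Algebra.trace F K (b * Algebra.norm K (d : L)) = 0 then 0 else 1

omit [Fintype F] [Fintype K] [Fintype L] in
theorem traceNormIndicator_mul (b : K) (d : Lˣ) {t : Lˣ} {s : F} (hs : s ≠ 0)
    (ht : Algebra.norm K (t : L) = algebraMap F K s) :
    traceNormIndicator F b (d * t) = traceNormIndicator F b d := by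
  rw [traceNormIndicator, traceNormIndicator, Units.val_mul, map_mul (Algebra.norm K), ht,
    ← mul_assoc, mul_comm _ (algebraMap F K s),
    ← Algebra.smul_def, map_smul, smul_eq_mul]
  split_ifs <;> simp_all

omit [Fintype L] in
variable (F K) in
theorem norm_pow_eq_algebraMap (x : Lˣ) :
    ∃ s : F, s ≠ 0 ∧ Algebra.norm K
      ((x ^ ((Fintype.card K - 1) / (Fintype.card F - 1)) : Lˣ) : L) = algebraMap F K s := by
  refine ⟨Algebra.norm F (Units.map (Algebra.norm K) x : K),
    (Units.map (Algebra.norm F) (Units.map (Algebra.norm K) x)).ne_zero, ?_⟩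
  rw [algebraMap_norm_eq_pow, Nat.card_eq_fintype_card, Nat.card_eq_fintype_card]
  simp

-- As y runs over Lˣ its norm covers Kˣ uniformly, so the sum counts nonzeros of the form with
-- coefficient b N(d).
open scoped Classical in
theorem sum_traceNormIndicator_mul_pow {k : ℕ} (hk : Module.finrank F K = 2 * k) (b : Kˣ)
    (d : Lˣ) :
    (Fintype.card F : ℤ) * (Fintype.card K - 1) *
      ∑ y : Lˣ, traceNormIndicator F (b : K) (d * y ^ (Fintype.card F + 1)) =
      (Fintype.card L - 1) * (Fintype.card F - 1) *
        (Fintype.card K - traceFormSum F k (b * Algebra.norm K (d : L))) := by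
  classical
  have hL : 1 ≤ Fintype.card L := Fintype.card_pos
  have hK : 1 ≤ Fintype.card K := Fintype.card_pos
  have h := MonoidHom.card_filter_mul_card (Units.map (Algebra.norm K (S := L)))
    (unitsMap_norm_surjective K L)
    (fun a => ¬ traceForm F ((b : K) * Algebra.norm K (d : L)) (a : K) = 0)
  have hz : traceFormZeros F ((b : K) * Algebra.norm K (d : L)) +
      #{u : Kˣ | ¬ traceForm F ((b : K) * Algebra.norm K (d : L)) (u : K) = 0} =
      Fintype.card K := by
    have hu := card_filter_eq_add_card_units
      (fun y => ¬ traceForm F ((b : K) * Algebra.norm K (d : L)) y = 0)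
    rw [if_neg (by simp [traceForm_zero]), zero_add] at hu
    rw [← hu, ← card_univ, ← card_filter_add_card_filter_not (s := univ)
      (fun y => traceForm F ((b : K) * Algebra.norm K (d : L)) y = 0), traceFormZeros]
  have hsum : ∑ y : Lˣ, traceNormIndicator F (b : K) (d * y ^ (Fintype.card F + 1)) =
      (#{y : Lˣ | ¬ traceForm F ((b : K) * Algebra.norm K (d : L))
        (Units.map (Algebra.norm K (S := L)) y : K) = 0} : ℤ) := by
    rw [card_filter]
    push_cast
    refine sum_congr rfl fun y _ => ?_
    rw [traceNormIndicator, traceForm]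
    simp [mul_assoc]
  rw [Fintype.card_units, Fintype.card_units] at h
  zify [hL, hK] at h hz
  have hne : (b : K) * Algebra.norm K (d : L) ≠ 0 :=
    (b * Units.map (Algebra.norm K (S := L)) d).ne_zero
  have hZ := traceFormZeros_eq hk hne
  rw [hsum]
  linear_combination (Fintype.card F : ℤ) * h + (Fintype.card F : ℤ) * (Fintype.card L - 1) * hz -
    (Fintype.card L - 1) * hZ

end Tower

/-! ### Correlating the two subfields -/

section Compositum

variable {F K₁ K₂ L : Type*} [Field F] [Field K₁] [Field K₂] [Field L] [Fintype F] [Fintype K₁]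
  [Fintype K₂] [Fintype L] [Algebra F K₁] [Algebra F K₂] [Algebra K₁ L] [Algebra K₂ L]

-- The second factor is a constant minus a multiple of the indicator that N₂(d) has a radical. The
-- constant part sums to zero; the indicator is supported on a single coset e y^(q+1), where the
-- first factor is constant.
open scoped Classical in
theorem sum_traceFormSum_mul_traceFormSum {k₁ k₂ : ℕ} (hk₁ : Module.finrank F K₁ = 2 * k₁)
    (hk₂ : Module.finrank F K₂ = 2 * k₂) (b : K₁ˣ) {e : Lˣ}
    (he : HasRadical F (Algebra.norm K₂ (e : L))) :
    ∑ d : Lˣ, traceFormSum F k₁ ((b : K₁) * Algebra.norm K₁ (d : L)) *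
        traceFormSum F k₂ (Algebra.norm K₂ (d : L)) =
      -((-(Fintype.card F : ℤ)) ^ k₂ * (Fintype.card L - 1) *
        traceFormSum F k₁ ((b : K₁) * Algebra.norm K₁ (e : L))) := by
  classical
  have hL : 1 ≤ Fintype.card L := Fintype.card_pos
  have hterm (d : Lˣ) : traceFormSum F k₁ ((b : K₁) * Algebra.norm K₁ (d : L)) *
      traceFormSum F k₂ (Algebra.norm K₂ (d : L)) =
      (-(Fintype.card F : ℤ)) ^ k₂ * traceFormSum F k₁ ((b : K₁) * Algebra.norm K₁ (d : L)) -
      (-(Fintype.card F : ℤ)) ^ k₂ * (Fintype.card F + 1) *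
        traceFormSum F k₁ ((b : K₁) * Algebra.norm K₁ (e : L)) *
        (if HasRadical F (Algebra.norm K₂ (d : L)) then 1 else 0) := by
    rw [traceFormSum_eq_mul k₂]
    split_ifs with hd
    · obtain ⟨y, rfl⟩ := exists_eq_mul_pow_of_hasRadical_norm hk₂ hd he
      have : traceFormSum F k₁ ((b : K₁) * Algebra.norm K₁ ((e * y ^ (Fintype.card F + 1) : Lˣ) : L)) =
          traceFormSum F k₁ ((b : K₁) * Algebra.norm K₁ (e : L)) := by
        have hy := hasRadical_mul_pow_iff (F := F) ((b : K₁) * Algebra.norm K₁ (e : L))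
          (Units.map (Algebra.norm K₁ (S := L)) y)
        have hmul : (b : K₁) * Algebra.norm K₁ ((e * y ^ (Fintype.card F + 1) : Lˣ) : L) =
            (b : K₁) * Algebra.norm K₁ (e : L) *
              (Units.map (Algebra.norm K₁ (S := L)) y : K₁) ^ (Fintype.card F + 1) := by
          simp [mul_assoc]
        rw [traceFormSum, hmul]
        simp only [hy]
        rfl
      rw [this]
      ring
    · ring
  have hcard := card_hasRadical_norm (L := L) hk₂ 1
  simp only [Units.val_one, one_mul] at hcard
  zify [hL] at hcard
  rw [sum_congr rfl fun d _ => hterm d, sum_sub_distrib, ← mul_sum, sum_traceFormSum_norm hk₁,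
    ← mul_sum, sum_boole, ← hcard]
  ring

open scoped Classical in
theorem sum_traceNormIndicator_mul {k₁ k₂ : ℕ} (hk₁ : Module.finrank F K₁ = 2 * k₁)
    (hk₂ : Module.finrank F K₂ = 2 * k₂)
    (hgcd : Nat.gcd ((Fintype.card K₁ - 1) / (Fintype.card F - 1))
      ((Fintype.card K₂ - 1) / (Fintype.card F - 1)) = Fintype.card F + 1)
    (b : K₁ˣ) {e : Lˣ} (he : HasRadical F (Algebra.norm K₂ (e : L))) :
    (Fintype.card F : ℤ) ^ 2 * (Fintype.card K₁ - 1) * (Fintype.card K₂ - 1) *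
      ∑ d : Lˣ, traceNormIndicator F (b : K₁) d * traceNormIndicator F (1 : K₂) d =
    (Fintype.card F - 1) ^ 2 * (Fintype.card L - 1) *
      (Fintype.card K₁ * Fintype.card K₂ - (-(Fintype.card F : ℤ)) ^ k₂ *
        traceFormSum F k₁ ((b : K₁) * Algebra.norm K₁ (e : L))) := by
  classical
  have hL := Fintype.one_lt_card (α := L)
  have hLz : (1 : ℤ) < Fintype.card L := by exact_mod_cast hL
  have h := Finset.sum_mul_sum_pow_gcd (G := Lˣ) (traceNormIndicator F (b : K₁))
    (traceNormIndicator F (1 : K₂))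
    (fun d x => by
      obtain ⟨s, hs, hx⟩ := norm_pow_eq_algebraMap F K₁ x
      exact traceNormIndicator_mul (b : K₁) d hs hx)
    (fun d x => by
      obtain ⟨s, hs, hx⟩ := norm_pow_eq_algebraMap F K₂ x
      exact traceNormIndicator_mul (1 : K₂) d hs hx)
  rw [hgcd, Fintype.card_units, Nat.cast_sub hL.le] at h
  have hprod (d : Lˣ) : (Fintype.card F : ℤ) ^ 2 * (Fintype.card K₁ - 1) * (Fintype.card K₂ - 1) *
      ((∑ y : Lˣ, traceNormIndicator F (b : K₁) (d * y ^ (Fintype.card F + 1))) *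
        ∑ y : Lˣ, traceNormIndicator F (1 : K₂) (d * y ^ (Fintype.card F + 1))) =
      (Fintype.card L - 1) ^ 2 * (Fintype.card F - 1) ^ 2 *
        (Fintype.card K₁ * Fintype.card K₂ -
          Fintype.card K₂ * traceFormSum F k₁ ((b : K₁) * Algebra.norm K₁ (d : L)) -
          Fintype.card K₁ * traceFormSum F k₂ (Algebra.norm K₂ (d : L)) +
          traceFormSum F k₁ ((b : K₁) * Algebra.norm K₁ (d : L)) *
            traceFormSum F k₂ (Algebra.norm K₂ (d : L))) := by
    have h1 := sum_traceNormIndicator_mul_pow hk₁ b d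
    have h2 := sum_traceNormIndicator_mul_pow hk₂ 1 d
    rw [Units.val_one, one_mul] at h2
    linear_combination (Fintype.card F * (Fintype.card K₂ - 1) *
      ∑ y : Lˣ, traceNormIndicator F (1 : K₂) (d * y ^ (Fintype.card F + 1))) * h1 +
      ((Fintype.card L - 1) * (Fintype.card F - 1) *
        (Fintype.card K₁ - traceFormSum F k₁ (b * Algebra.norm K₁ (d : L)))) * h2
  have hS2 := sum_traceFormSum_norm (L := L) hk₂ 1
  rw [Units.val_one] at hS2
  simp only [one_mul] at hS2
  have hsum := congrArg ((Fintype.card F : ℤ) ^ 2 * (Fintype.card K₁ - 1) *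
    (Fintype.card K₂ - 1) * ·) h
  rw [mul_sum, sum_congr rfl fun d _ => hprod d, ← mul_sum, sum_add_distrib, sum_sub_distrib,
    sum_sub_distrib, sum_const, ← mul_sum, ← mul_sum, sum_traceFormSum_norm hk₁, hS2,
    sum_traceFormSum_mul_traceFormSum hk₁ hk₂ b he, card_univ, Fintype.card_units,
    nsmul_eq_mul, Nat.cast_sub hL.le] at hsum
  have hne : ((Fintype.card L : ℤ) - 1) ^ 2 ≠ 0 := pow_ne_zero _ (by linarith)
  apply mul_left_cancel₀ hne
  push_cast at hsum
  linear_combination -hsum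

/-- Take t = x^M with M = (|K₁|-1)/(q-1), which puts N₁(t) in F. As gcd(M, |K₂|-1) = q+1, Bézout
makes w^(q+1) = s an M-th power in K₂ˣ, and surjectivity of the norm supplies x. -/
theorem exists_norm_eq_algebraMap {k : ℕ} (hk : Module.finrank F K₂ = 2 * k)
    (hgcd : Nat.gcd ((Fintype.card K₁ - 1) / (Fintype.card F - 1)) (Fintype.card K₂ - 1) =
      Fintype.card F + 1) {s : F} (hs : s ≠ 0) :
    ∃ t : Lˣ, Algebra.norm K₂ (t : L) = algebraMap F K₂ s ∧
      ∃ r : F, r ≠ 0 ∧ Algebra.norm K₁ (t : L) = algebraMap F K₁ r := by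
  classical
  obtain ⟨w, hw⟩ := exists_pow_card_add_one_eq hk hs
  obtain ⟨x, hx⟩ := unitsMap_norm_surjective K₂ L
    (w ^ ((Fintype.card K₁ - 1) / (Fintype.card F - 1)).gcdA (Fintype.card K₂ - 1))
  refine ⟨x ^ ((Fintype.card K₁ - 1) / (Fintype.card F - 1)), ?_, norm_pow_eq_algebraMap F K₁ x⟩
  have hbez : w ^ (Fintype.card F + 1) =
      (w ^ ((Fintype.card K₁ - 1) / (Fintype.card F - 1)).gcdA (Fintype.card K₂ - 1)) ^
        ((Fintype.card K₁ - 1) / (Fintype.card F - 1)) := by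
    rw [← hgcd, ← zpow_natCast, Nat.gcd_eq_gcd_ab, zpow_add, zpow_mul', zpow_mul, zpow_natCast,
      zpow_natCast, ← Fintype.card_units (α := K₂), pow_card_eq_one, one_zpow, mul_one]
  rw [← hx, ← map_pow] at hbez
  rw [← hw, ← Units.val_pow_eq_pow_val, hbez]
  rfl

end Compositum

end FiniteField

/-! ### Greatest common divisors of the exponents -/

theorem Nat.gcd_repunit {q m n : ℕ} (hq : 2 ≤ q) (h : m.gcd n = 2) :
    Nat.gcd ((q ^ m - 1) / (q - 1)) ((q ^ n - 1) / (q - 1)) = q + 1 := by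
  have hdvd (m : ℕ) : q - 1 ∣ q ^ m - 1 := by simpa using Nat.sub_dvd_pow_sub_pow q 1 m
  rw [Nat.gcd_div (hdvd m) (hdvd n), Nat.pow_sub_one_gcd_pow_sub_one, h, Nat.sq_sub_one,
    Nat.mul_div_cancel _ (by omega)]

/-- Write the gcd as (q+1)c. Then c divides q-1, so q² ≡ 1 mod c; c also divides the sum of (q²)^i
over i < k, which is ≡ k. Hence c divides gcd(k, q-1) = 1. -/
theorem Nat.gcd_repunit_pow_sub_one {q k n : ℕ} (hq : 2 ≤ q) (h : (2 * k).gcd n = 2)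
    (hk : k.gcd (q - 1) = 1) :
    Nat.gcd ((q ^ (2 * k) - 1) / (q - 1)) (q ^ n - 1) = q + 1 := by
  have hq1 : 0 < q - 1 := by omega
  have hdvd (m : ℕ) : q - 1 ∣ q ^ m - 1 := by simpa using Nat.sub_dvd_pow_sub_pow q 1 m
  have hM : (q ^ (2 * k) - 1) / (q - 1) = (q + 1) * ∑ i ∈ Finset.range k, (q ^ 2) ^ i := by
    have := Nat.geomSum_eq (m := q ^ 2) (by nlinarith) k
    rw [this, pow_mul, ← Nat.mul_div_assoc, Nat.sq_sub_one, Nat.mul_div_mul_left _ _ (by omega)]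
    simpa using Nat.sub_dvd_pow_sub_pow (q ^ 2) 1 k
  have hle : q + 1 ∣ Nat.gcd ((q ^ (2 * k) - 1) / (q - 1)) (q ^ n - 1) := by
    rw [← Nat.gcd_repunit hq h]
    exact Nat.gcd_dvd_gcd_of_dvd_right _ (Nat.div_dvd_of_dvd (hdvd n))
  obtain ⟨c, hc⟩ := hle
  have h1 : (q + 1) * c ∣ (q + 1) * (q - 1) := by
    have hg := Nat.pow_sub_one_gcd_pow_sub_one q (2 * k) n
    rw [h] at hg
    rw [← hc, ← Nat.sq_sub_one, ← hg]
    exact Nat.gcd_dvd_gcd_of_dvd_left _ (Nat.div_dvd_of_dvd (hdvd _))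
  have h2 : (q + 1) * c ∣ (q + 1) * ∑ i ∈ Finset.range k, (q ^ 2) ^ i := by
    rw [← hc, ← hM]
    exact Nat.gcd_dvd_left _ _
  replace h1 := Nat.dvd_of_mul_dvd_mul_left (Nat.succ_pos q) h1
  replace h2 := Nat.dvd_of_mul_dvd_mul_left (Nat.succ_pos q) h2
  have hq2 : q ^ 2 ≡ 1 [MOD c] := by
    refine ((Nat.modEq_iff_dvd' (Nat.one_le_pow _ _ (by omega))).2 ?_).symm
    rw [Nat.sq_sub_one]
    exact h1.mul_left _
  have hsum : ∑ i ∈ Finset.range k, (q ^ 2) ^ i ≡ k [MOD c] := by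
    have : ∑ i ∈ Finset.range k, (q ^ 2) ^ i ≡ ∑ i ∈ Finset.range k, 1 [MOD c] :=
      Nat.ModEq.sum fun i _ => by simpa using hq2.pow i
    simpa using this
  have hck : c ∣ k := (hsum.dvd_iff dvd_rfl).1 h2
  have : c = 1 := Nat.dvd_one.1 (hk ▸ Nat.dvd_gcd hck h1)
  rw [hc, this, mul_one]

/-! ### Weights and length of the code -/

namespace FiniteField

open Finset

section Code

variable {F K₁ K₂ L : Type*} [Field F] [Field K₁] [Field K₂] [Field L] [Fintype F] [Fintype K₁]
  [Fintype K₂] [Fintype L] [Algebra F K₁] [Algebra F K₂] [Algebra K₁ L] [Algebra K₂ L]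

omit [Fintype F] [Fintype K₁] [Fintype K₂] in
open scoped Classical in
theorem hammingNorm_encode_definingSet (b : K₁) :
    hammingNorm (encode F K₁ (definingSet F K₂ L (1 : F)) b) =
      #{d : Lˣ | Algebra.trace F K₁ (b * Algebra.norm K₁ (d : L)) ≠ 0 ∧
        Algebra.trace F K₂ (Algebra.norm K₂ (d : L)) = -1} := by
  rw [hammingNorm]
  symm
  refine card_bij (fun d hd => ⟨d, d.ne_zero, ?_⟩) ?_ ?_ ?_
  · rw [(mem_filter.1 hd).2.2, neg_add_cancel]
  · intro d hd
    exact mem_filter.2 ⟨mem_univ _, (mem_filter.1 hd).2.1⟩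
  · intro d _ d' _ h
    exact Units.ext (congrArg Subtype.val h)
  · rintro ⟨d, hd0, hd⟩ h
    refine ⟨Units.mk0 d hd0, ?_, rfl⟩
    simp only [mem_filter, mem_univ, true_and]
    exact ⟨(mem_filter.1 h).2, eq_neg_of_add_eq_zero_left hd⟩

-- Multiplying d by t from `exists_norm_eq_algebraMap` rescales both traces by nonzero scalars and
-- moves the second to -1, so each of its q-1 nonzero values contributes one copy of the weight.
open scoped Classical in
theorem card_sub_one_mul_hammingNorm {k : ℕ} (hk : Module.finrank F K₂ = 2 * k)
    (hgcd : Nat.gcd ((Fintype.card K₁ - 1) / (Fintype.card F - 1)) (Fintype.card K₂ - 1) =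
      Fintype.card F + 1) (b : K₁) :
    ((Fintype.card F : ℤ) - 1) * hammingNorm (encode F K₁ (definingSet F K₂ L (1 : F)) b) =
      ∑ d : Lˣ, traceNormIndicator F b d * traceNormIndicator F (1 : K₂) d := by
  have hF : 1 ≤ Fintype.card F := Fintype.card_pos
  have hfib (s : F) (hs : s ∈ univ.erase (0 : F)) :
      #{d : Lˣ | Algebra.trace F K₁ (b * Algebra.norm K₁ (d : L)) ≠ 0 ∧
        Algebra.trace F K₂ (Algebra.norm K₂ (d : L)) = s} =
      #{d : Lˣ | Algebra.trace F K₁ (b * Algebra.norm K₁ (d : L)) ≠ 0 ∧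
        Algebra.trace F K₂ (Algebra.norm K₂ (d : L)) = -1} := by
    rw [mem_erase] at hs
    obtain ⟨t, ht, r, hr, hr'⟩ := exists_norm_eq_algebraMap (K₁ := K₁) (L := L) hk hgcd
      (div_ne_zero (neg_ne_zero.2 one_ne_zero) hs.1)
    refine card_bijective (Equiv.mulRight t) (Equiv.mulRight t).bijective fun d => ?_
    have h1 : Algebra.trace F K₁ (b * Algebra.norm K₁ ((d * t : Lˣ) : L)) =
        r * Algebra.trace F K₁ (b * Algebra.norm K₁ (d : L)) := by
      rw [Units.val_mul, map_mul (Algebra.norm K₁), hr', ← mul_assoc, mul_comm _ (algebraMap F _ _),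
        ← Algebra.smul_def, map_smul, smul_eq_mul]
    have h2 : Algebra.trace F K₂ (Algebra.norm K₂ ((d * t : Lˣ) : L)) =
        -1 / s * Algebra.trace F K₂ (Algebra.norm K₂ (d : L)) := by
      rw [Units.val_mul, map_mul (Algebra.norm K₂), ht, mul_comm _ (algebraMap F _ _),
        ← Algebra.smul_def, map_smul, smul_eq_mul]
    simp only [mem_filter, mem_univ, true_and, Equiv.coe_mulRight, h1, h2]
    rw [mul_ne_zero_iff, and_iff_right hr, div_mul_eq_mul_div, div_eq_iff hs.1]
    simp
  have hind (d : Lˣ) : traceNormIndicator F b d * traceNormIndicator F (1 : K₂) d =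
      if Algebra.trace F K₁ (b * Algebra.norm K₁ (d : L)) ≠ 0 ∧
        Algebra.trace F K₂ (Algebra.norm K₂ (d : L)) ≠ 0 then 1 else 0 := by
    rw [traceNormIndicator, traceNormIndicator, one_mul]
    split_ifs <;> simp_all
  rw [sum_congr rfl fun d _ => hind d, sum_boole, card_eq_sum_card_fiberwise
    (f := fun d : Lˣ => Algebra.trace F K₂ (Algebra.norm K₂ (d : L))) (t := univ.erase 0)]
  · have hsum := sum_congr rfl hfib
    rw [sum_const, card_erase_of_mem (mem_univ _), card_univ,
      ← hammingNorm_encode_definingSet, smul_eq_mul] at hsum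
    rw [← Nat.cast_pred hF, ← Nat.cast_mul, ← hsum]
    congr 1
    refine sum_congr rfl fun s hs => ?_
    congr 1
    ext d
    rw [mem_erase] at hs
    simp only [mem_filter, mem_univ, true_and]
    constructor
    · rintro ⟨h, rfl⟩
      exact ⟨⟨h, hs.1⟩, rfl⟩
    · rintro ⟨⟨h, _⟩, h'⟩
      exact ⟨h, h'⟩
  · intro d hd
    simpa using (mem_filter.1 (mem_coe.1 hd)).2.2

open scoped Classical in
theorem hammingNorm_encode_eq {k₁ k₂ : ℕ} (hk₁ : Module.finrank F K₁ = 2 * k₁)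
    (hk₂ : Module.finrank F K₂ = 2 * k₂) (h : Nat.gcd (2 * k₁) (2 * k₂) = 2)
    (hk : k₁.gcd (Fintype.card F - 1) = 1) {e : Lˣ}
    (he : HasRadical F (Algebra.norm K₂ (e : L))) (b : K₁ˣ) :
    (Fintype.card F : ℤ) ^ 2 * (Fintype.card K₁ - 1) * (Fintype.card K₂ - 1) *
      hammingNorm (encode F K₁ (definingSet F K₂ L (1 : F)) (b : K₁)) =
    (Fintype.card F - 1) * (Fintype.card L - 1) *
      (Fintype.card K₁ * Fintype.card K₂ - (-(Fintype.card F : ℤ)) ^ k₂ *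
        traceFormSum F k₁ ((b : K₁) * Algebra.norm K₁ (e : L))) := by
  have hF : 2 ≤ Fintype.card F := Fintype.one_lt_card
  have hFz : (2 : ℤ) ≤ Fintype.card F := by exact_mod_cast hF
  have hg1 : Nat.gcd ((Fintype.card K₁ - 1) / (Fintype.card F - 1))
      ((Fintype.card K₂ - 1) / (Fintype.card F - 1)) = Fintype.card F + 1 := by
    rw [Module.card_eq_pow_finrank (K := F) (V := K₁),
      Module.card_eq_pow_finrank (K := F) (V := K₂), hk₁, hk₂, Nat.gcd_repunit hF h]
  have hg2 : Nat.gcd ((Fintype.card K₁ - 1) / (Fintype.card F - 1)) (Fintype.card K₂ - 1) =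
      Fintype.card F + 1 := by
    rw [Module.card_eq_pow_finrank (K := F) (V := K₁),
      Module.card_eq_pow_finrank (K := F) (V := K₂), hk₁, hk₂,
      Nat.gcd_repunit_pow_sub_one hF h hk]
  have h1 := sum_traceNormIndicator_mul hk₁ hk₂ hg1 b he
  have h2 := card_sub_one_mul_hammingNorm (L := L) hk₂ hg2 (b : K₁)
  apply mul_left_cancel₀ (by linarith : (Fintype.card F : ℤ) - 1 ≠ 0)
  linear_combination h1 + (Fintype.card F : ℤ) ^ 2 * (Fintype.card K₁ - 1) *
    (Fintype.card K₂ - 1) * h2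

-- The norm is uniform onto K₂ˣ, where the trace takes the value -1 exactly |K₂|/q times.
omit [Fintype K₁] [Algebra F K₁] [Algebra K₁ L] [Field K₁] in
theorem card_definingSet :
    Fintype.card (definingSet F K₂ L (1 : F)) * (Fintype.card K₂ - 1) * Fintype.card F =
      Fintype.card K₂ * (Fintype.card L - 1) := by
  classical
  have hD : Fintype.card (definingSet F K₂ L (1 : F)) =
      #{d : Lˣ | Algebra.trace F K₂ (Units.map (Algebra.norm K₂ (S := L)) d : K₂) = -1} := by
    rw [← card_univ]
    symm
    refine card_bij (fun d hd => ⟨d, d.ne_zero, ?_⟩) (fun d hd => mem_univ _) ?_ ?_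
    · have := (mem_filter.1 hd).2
      rw [Units.coe_map] at this
      exact (congrArg (· + 1) this).trans (neg_add_cancel 1)
    · intro d _ d' _ h
      exact Units.ext (congrArg Subtype.val h)
    · rintro ⟨d, hd0, hd⟩ h
      refine ⟨Units.mk0 d hd0, ?_, rfl⟩
      simp only [mem_filter, mem_univ, true_and]
      exact eq_neg_of_add_eq_zero_left hd
  have h := MonoidHom.card_filter_mul_card (Units.map (Algebra.norm K₂ (S := L)))
    (unitsMap_norm_surjective K₂ L) (fun a => Algebra.trace F K₂ (a : K₂) = -1)
  have hu := card_filter_eq_add_card_units (fun a : K₂ => Algebra.trace F K₂ a = -1)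
  rw [if_neg (by simp), zero_add] at hu
  have hc := LinearMap.card_fiber_mul_card _ (trace_mul_left_ne_zero (F := F)
    (one_ne_zero (α := K₂))) (-1)
  simp only [LinearMap.comp_apply, LinearMap.mulLeft_apply, one_mul] at hc
  rw [hD, ← Fintype.card_units, h, Fintype.card_units, ← hu, mul_right_comm]
  congr 1

end Code

end FiniteField

/-! ### From the weights of nonzero messages to the weight enumerator -/

namespace FiniteField

open Finset

theorem sum_eq_add_sum_units {K R : Type*} [Field K] [Fintype K] [DecidableEq K]
    [AddCommMonoid R] (f : K → R) : ∑ x, f x = f 0 + ∑ u : Kˣ, f u := by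
  rw [← add_sum_erase _ _ (mem_univ (0 : K))]
  congr 1
  symm
  refine sum_bij (fun u _ => (u : K)) (by simp) (by simp [Units.ext_iff]) ?_ (by simp)
  intro y hy
  exact ⟨Units.mk0 y (ne_of_mem_erase hy), mem_univ _, rfl⟩

end FiniteField

open scoped Classical in
theorem weightEnumerator_eq_of_injective {F ι K : Type*} [Field F] [Fintype F] [Fintype ι]
    [Field K] [Fintype K] [Algebra F K] (φ : K →ₗ[F] ι → F) (hφ : Function.Injective φ)
    (P : Kˣ → Prop) {w₁ w₂ : ℕ}
    (h₁ : ∀ u, P u → hammingNorm (φ u) = w₁) (h₂ : ∀ u, ¬ P u → hammingNorm (φ u) = w₂) :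
    weightEnumerator (LinearMap.range φ) =
      1 + C (Finset.card {u : Kˣ | P u}) * X ^ w₁ + C (Finset.card {u : Kˣ | ¬ P u}) * X ^ w₂ := by
  rw [weightEnumerator]
  refine (Finset.sum_equiv (t := Finset.univ) (LinearEquiv.ofInjective φ hφ).symm.toEquiv
    (g := fun x => (X : ℕ[X]) ^ hammingNorm (φ x)) (by simp) fun c _ => ?_).trans ?_
  · rw [LinearEquiv.coe_toEquiv, LinearEquiv.ofInjective_symm_apply]
  rw [FiniteField.sum_eq_add_sum_units]
  have hsplit (u : Kˣ) : (X : ℕ[X]) ^ hammingNorm (φ u) =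
      (if P u then X ^ w₁ else 0) + if ¬ P u then X ^ w₂ else 0 := by
    by_cases hu : P u
    · simp [hu, h₁ u hu]
    · simp [hu, h₂ u hu]
  rw [Finset.sum_congr rfl fun u _ => hsplit u, Finset.sum_add_distrib, ← Finset.sum_filter,
    ← Finset.sum_filter, Finset.sum_const, Finset.sum_const, map_zero, hammingNorm_zero, pow_zero,
    add_assoc, nsmul_eq_mul, nsmul_eq_mul]
  simp

open scoped Classical in
theorem isTwoWeightCode_of_injective {F ι K : Type*} [Field F] [Fintype ι]
    [Field K] [Algebra F K] (φ : K →ₗ[F] ι → F) (hφ : Function.Injective φ) (P : Kˣ → Prop)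
    {w₁ w₂ : ℕ} (hw : w₁ ≠ w₂) (hP : ∃ u, P u) (hP' : ∃ u, ¬ P u)
    (h₁ : ∀ u, P u → hammingNorm (φ u) = w₁) (h₂ : ∀ u, ¬ P u → hammingNorm (φ u) = w₂) :
    IsTwoWeightCode (LinearMap.range φ) := by
  have hne (u : Kˣ) : φ u ≠ 0 := (map_ne_zero_iff φ hφ).2 u.ne_zero
  have hset : nonzeroWeights (LinearMap.range φ) = {w₁, w₂} := by
    ext w
    constructor
    · rintro ⟨_, ⟨x, rfl⟩, hx, rfl⟩
      have hx0 : x ≠ 0 := fun h => hx (by rw [h, map_zero])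
      by_cases hu : P (Units.mk0 x hx0)
      · exact Or.inl (h₁ _ hu)
      · exact Or.inr (h₂ _ hu)
    · rintro (rfl | rfl)
      · obtain ⟨u, hu⟩ := hP
        exact ⟨φ u, ⟨u, rfl⟩, hne u, h₁ u hu⟩
      · obtain ⟨u, hu⟩ := hP'
        exact ⟨φ u, ⟨u, rfl⟩, hne u, h₂ u hu⟩
  rw [IsTwoWeightCode, hset, Set.ncard_pair hw]

/-! ### Assembly of the main theorem -/

theorem theorem4p5 {F K₁ K₂ L : Type*} [Field F] [Field K₁] [Field K₂] [Field L]
    [Fintype F] [Fintype L]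
    [Algebra F K₁] [Algebra F K₂] [Algebra F L] [Algebra K₁ L] [Algebra K₂ L]
    [IsScalarTower F K₁ L] [IsScalarTower F K₂ L]
    (q m m₁ m₂ : ℕ)
    (hq : Fintype.card F = q)
    (hm : Module.finrank F L = m)
    (hm₁ : Module.finrank F K₁ = m₁)
    (hm₂ : Module.finrank F K₂ = m₂)
    (he : Nat.gcd m₁ m₂ = 2)
    (hl : Nat.gcd (m₁ / Nat.gcd m₁ m₂) (q - 1) = 1) :
    IsTwoWeightCode (codeOf F K₁ (definingSet F K₂ L (1 : F))) ∧
    HasParameters (codeOf F K₁ (definingSet F K₂ L (1 : F)))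
      ((q : ℚ) ^ (m₂ - 1) * ((q : ℚ) ^ m - 1) / ((q : ℚ) ^ m₂ - 1)) m₁ ∧
    ∃ w₁ w₂ A₁ A₂ : ℕ,
      (w₁ : ℚ) = ((q : ℚ) - 1) * ((q : ℚ) ^ m - 1) *
          ((q : ℚ) ^ (m₁ + m₂) + (-1) ^ ((m₁ + m₂) / 2) * (q : ℚ) ^ ((m₁ + m₂) / 2 + 1)) /
          ((q : ℚ) ^ 2 * ((q : ℚ) ^ m₁ - 1) * ((q : ℚ) ^ m₂ - 1)) ∧
      (A₁ : ℚ) = ((q : ℚ) ^ m₁ - 1) / ((q : ℚ) + 1) ∧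
      (w₂ : ℚ) = ((q : ℚ) - 1) * ((q : ℚ) ^ m - 1) *
          ((q : ℚ) ^ (m₁ + m₂) + (-1) ^ ((m₁ + m₂) / 2 + 1) * (q : ℚ) ^ ((m₁ + m₂) / 2)) /
          ((q : ℚ) ^ 2 * ((q : ℚ) ^ m₁ - 1) * ((q : ℚ) ^ m₂ - 1)) ∧
      (A₂ : ℚ) = (q : ℚ) * ((q : ℚ) ^ m₁ - 1) / ((q : ℚ) + 1) ∧
      weightEnumerator (codeOf F K₁ (definingSet F K₂ L (1 : F))) =
        1 + Polynomial.C A₁ * Polynomial.X ^ w₁ + Polynomial.C A₂ * Polynomial.X ^ w₂ := by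
  classical
  have : Finite K₁ := Finite.of_injective _ (algebraMap K₁ L).injective
  have : Finite K₂ := Finite.of_injective _ (algebraMap K₂ L).injective
  have : Fintype K₁ := Fintype.ofFinite K₁
  have : Fintype K₂ := Fintype.ofFinite K₂
  obtain ⟨k₁, rfl⟩ : 2 ∣ m₁ := he ▸ Nat.gcd_dvd_left m₁ m₂
  obtain ⟨k₂, rfl⟩ : 2 ∣ m₂ := he ▸ Nat.gcd_dvd_right (2 * k₁) m₂
  have hk₁ : 0 < k₁ := by
    have : 0 < Module.finrank F K₁ := Module.finrank_pos
    omega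
  have hk₂ : 0 < k₂ := by
    have : 0 < Module.finrank F K₂ := Module.finrank_pos
    omega
  rw [he, Nat.mul_div_cancel_left _ two_pos] at hl
  have hQ₁ : Fintype.card K₁ = q ^ (2 * k₁) := by
    rw [Module.card_eq_pow_finrank (K := F) (V := K₁), hm₁, hq]
  have hQ₂ : Fintype.card K₂ = q ^ (2 * k₂) := by
    rw [Module.card_eq_pow_finrank (K := F) (V := K₂), hm₂, hq]
  have hQ : Fintype.card L = q ^ m := by
    rw [Module.card_eq_pow_finrank (K := F) (V := L), hm, hq]
  have hq2 : 2 ≤ q := hq ▸ Fintype.one_lt_card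
  have hqz : (2 : ℤ) ≤ q := by exact_mod_cast hq2
  have hqq : (2 : ℚ) ≤ q := by exact_mod_cast hq2
  have hQ₁1 : 1 < q ^ (2 * k₁) := hQ₁ ▸ Fintype.one_lt_card
  have hQ₂1 : 1 < q ^ (2 * k₂) := hQ₂ ▸ Fintype.one_lt_card
  have hQ1 : 1 < q ^ m := hQ ▸ Fintype.one_lt_card
  have hQ₁q : (1 : ℚ) < (q : ℚ) ^ (2 * k₁) := by exact_mod_cast hQ₁1
  have hQ₂q : (1 : ℚ) < (q : ℚ) ^ (2 * k₂) := by exact_mod_cast hQ₂1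
  have hQz : (1 : ℤ) < (q : ℤ) ^ m := by exact_mod_cast hQ1
  have hden : (q : ℚ) ^ 2 * ((q : ℚ) ^ (2 * k₁) - 1) * ((q : ℚ) ^ (2 * k₂) - 1) ≠ 0 :=
    mul_ne_zero (mul_ne_zero (pow_ne_zero _ (by linarith)) (by linarith)) (by linarith)
  -- The number of such e, times q+1, is |L| - 1 > 0.
  obtain ⟨e, hrad⟩ : ∃ e : Lˣ, FiniteField.HasRadical F (Algebra.norm K₂ (e : L)) := by
    have h := FiniteField.card_hasRadical_norm (L := L) hm₂ 1
    by_contra! hcon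
    rw [Finset.filter_false_of_mem (by simpa using hcon)] at h
    simp at h
    omega
  let P : K₁ˣ → Prop := fun b => FiniteField.HasRadical F ((b : K₁) * Algebra.norm K₁ (e : L))
  let wt : K₁ → ℕ := fun b => hammingNorm (encode F K₁ (definingSet F K₂ L (1 : F)) b)
  have hwt (b : K₁ˣ) : (q : ℤ) ^ 2 * ((q : ℤ) ^ (2 * k₁) - 1) * ((q : ℤ) ^ (2 * k₂) - 1) * wt b =
      (q - 1) * ((q : ℤ) ^ m - 1) * ((q : ℤ) ^ (2 * k₁) * (q : ℤ) ^ (2 * k₂) -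
        (-(q : ℤ)) ^ k₂ * (-(q : ℤ)) ^ (if P b then k₁ + 1 else k₁)) := by
    have h := FiniteField.hammingNorm_encode_eq hm₁ hm₂ he (hq.symm ▸ hl) hrad b
    rw [hQ₁, hQ₂, hQ, hq] at h
    push_cast at h
    rw [FiniteField.traceFormSum, hq] at h
    exact h
  have hdenz : (q : ℤ) ^ 2 * ((q : ℤ) ^ (2 * k₁) - 1) * ((q : ℤ) ^ (2 * k₂) - 1) ≠ 0 := by
    exact_mod_cast hden
  have hnum : ((q : ℤ) - 1) * ((q : ℤ) ^ m - 1) ≠ 0 :=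
    mul_ne_zero (by linarith) (by linarith)
  -- Weight zero would equate, in absolute value, q^(2k₁+2k₂) with q^(k₁+k₂) or q^(k₁+k₂+1),
  -- impossible for k₁, k₂ ≥ 1. This yields injectivity of the encoding, hence the dimension.
  have hwt0 (b : K₁ˣ) : wt b ≠ 0 := by
    intro h0
    have h := hwt b
    rw [h0, Nat.cast_zero, mul_zero, eq_comm, mul_eq_zero, or_iff_right hnum, sub_eq_zero,
      ← pow_add, ← pow_add] at h
    have habs := congrArg abs h
    rw [abs_pow, abs_pow, abs_neg, abs_of_pos (by linarith : (0 : ℤ) < q)] at habs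
    have := (pow_right_injective₀ (by linarith : (0 : ℤ) < q) (by linarith)) habs
    split_ifs at this <;> omega
  have hinj : Function.Injective (encode F K₁ (definingSet F K₂ L (1 : F))) := by
    refine (injective_iff_map_eq_zero _).2 fun b hb => ?_
    by_contra hb0
    refine hwt0 (Units.mk0 b hb0) ?_
    simp only [wt, Units.val_mk0, hb, hammingNorm_zero]
  -- Multiplication by N₁(e) reduces this to `card_hasRadical`.
  have hP : Finset.card {b : K₁ˣ | P b} * (q + 1) = q ^ (2 * k₁) - 1 := by
    have h := FiniteField.card_hasRadical hm₁
    rw [hq, hQ₁] at h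
    rw [← h]
    congr 1
    exact Finset.card_bijective (Equiv.mulRight (Units.map (Algebra.norm K₁ (S := L)) e))
      (Equiv.bijective _) (by simp [P])
  have hP' : Finset.card {b : K₁ˣ | P b} + Finset.card {b : K₁ˣ | ¬ P b} = q ^ (2 * k₁) - 1 := by
    rw [Finset.card_filter_add_card_filter_not, Finset.card_univ, Fintype.card_units, hQ₁]
  have hPpos : Finset.card {b : K₁ˣ | P b} ≠ 0 := by
    intro h
    rw [h] at hP
    omega
  have hP'pos : Finset.card {b : K₁ˣ | ¬ P b} ≠ 0 := by
    intro h
    have := Nat.pos_of_ne_zero hPpos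
    nlinarith
  obtain ⟨b₁, hb₁⟩ := Finset.card_ne_zero.1 hPpos
  obtain ⟨b₂, hb₂⟩ := Finset.card_ne_zero.1 hP'pos
  replace hb₁ : P b₁ := (Finset.mem_filter.1 hb₁).2
  replace hb₂ : ¬ P b₂ := (Finset.mem_filter.1 hb₂).2
  have hw₁ (b : K₁ˣ) (hb : P b) : wt b = wt b₁ := by
    have h := (hwt b).trans ((by rw [if_pos hb, if_pos hb₁] : _ = _).trans (hwt b₁).symm)
    exact_mod_cast mul_left_cancel₀ hdenz h
  have hw₂ (b : K₁ˣ) (hb : ¬ P b) : wt b = wt b₂ := by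
    have h := (hwt b).trans ((by rw [if_neg hb, if_neg hb₂] : _ = _).trans (hwt b₂).symm)
    exact_mod_cast mul_left_cancel₀ hdenz h
  -- Equal weights would force (-q)^(k₁+k₂) (-q-1) = 0.
  have hne : wt b₁ ≠ wt b₂ := by
    intro h
    have h1 := hwt b₁
    rw [h, hwt b₂, if_neg hb₂, if_pos hb₁] at h1
    have h2 := mul_left_cancel₀ hnum h1
    have h3 : ((-(q : ℤ)) ^ k₂ * (-(q : ℤ)) ^ k₁) * (-(q : ℤ) - 1) = 0 := by
      linear_combination h2
    have h4 : -(q : ℤ) ≠ 0 := by linarith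
    exact mul_ne_zero (mul_ne_zero (pow_ne_zero _ h4) (pow_ne_zero _ h4)) (by linarith) h3
  have hhalf : (2 * k₁ + 2 * k₂) / 2 = k₁ + k₂ := by omega
  have hPq : (Finset.card {b : K₁ˣ | P b} : ℚ) * (q + 1) = (q : ℚ) ^ (2 * k₁) - 1 := by
    have := congrArg (Nat.cast (R := ℚ)) hP
    push_cast [hQ₁1.le] at this
    exact this
  have hP'q : (Finset.card {b : K₁ˣ | P b} : ℚ) + Finset.card {b : K₁ˣ | ¬ P b} =
      (q : ℚ) ^ (2 * k₁) - 1 := by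
    have := congrArg (Nat.cast (R := ℚ)) hP'
    push_cast [hQ₁1.le] at this
    exact this
  refine ⟨isTwoWeightCode_of_injective _ hinj P hne ⟨b₁, hb₁⟩ ⟨b₂, hb₂⟩ hw₁ hw₂, ⟨?_, ?_⟩,
    wt b₁, wt b₂, _, _, ?_, ?_, ?_, ?_, weightEnumerator_eq_of_injective _ hinj P hw₁ hw₂⟩
  · have h := FiniteField.card_definingSet (F := F) (K₂ := K₂) (L := L)
    rw [hQ₂, hQ, hq] at h
    have h' := congrArg (Nat.cast (R := ℚ)) h
    push_cast [hQ₂1.le, hQ1.le] at h'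
    obtain ⟨l, hl⟩ : ∃ l, 2 * k₂ = l + 1 := ⟨2 * k₂ - 1, by omega⟩
    rw [eq_div_iff (by linarith)]
    rw [hl] at h' ⊢
    rw [Nat.add_sub_cancel]
    apply mul_right_cancel₀ (by linarith : (q : ℚ) ≠ 0)
    linear_combination h'
  · rw [codeOf, LinearMap.finrank_range_of_inj hinj, hm₁]
  · rw [hhalf, eq_div_iff hden]
    have h := congrArg (Int.cast (R := ℚ)) (hwt b₁)
    rw [if_pos hb₁] at h
    push_cast at h
    linear_combination h
  · rw [eq_div_iff (by linarith), hPq]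
  · rw [hhalf, eq_div_iff hden]
    have h := congrArg (Int.cast (R := ℚ)) (hwt b₂)
    rw [if_neg hb₂] at h
    push_cast at h
    linear_combination h
  · rw [eq_div_iff (by linarith)]
    linear_combination (q + 1 : ℚ) * hP'q - hPq
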